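/- Let $p$ be a prime and let $k,j$ be positive integers with $k-j\ge j$. Let $G=C_{p^k}\rtimes C_{p^j}$ be the group with presentation $$\langle a,b \mid a^{p^k}=b^{p^j}=1,\ bab^{-1}=a^{p^{k-j}+1}\rangle$$ (a finite group of order $p^{k+j}$), and let $V$ be a faithful irreducible (finite-dimensional) $\mathbb{C}G$-module. For $n\ge 0$ let $b(n)$ be the number of indecomposable summands, counted with multiplicity, in a decomposition of $V^{\otimes n}$ into indecomposable $\mathbb{C}G$-modules, and let $$a(n)=\frac{1}{|G|}\sum_{\substack{t\\ g_t\in Z_V(G)}} S_t\,\omega_V(g_t)^n\,(\dim V)^n$$ be the asymptotic growth rate of $V$; here $g_t$ runs over representatives of the conjugacy classes of $G$, $Z_V(G)$ is the set of $g\in G$ that act on $V$ by a scalar, $\omega_V(g)$ is that scalar, and $S_t$ is the sum of the values at $g_t^{-1}$ of all irreducible complex characters of $G$. Let $[\omega_i^n]=\sum_\omega \omega^n$, the sum being over all primitive $p^i$-th roots of unity $\omega\in\mathbb{C}$. Then $\dim V=p^j$, the number $b(n)$ does not depend on the decomposition, and for all $n\ge 0$ $$b(n)=a(n)=\frac{(p^j)^n}{p^{k+j}}\left((j+1)p^k-jp^{k-1}+(p^k-p^{k-1})\sum_{m=0}^{j-1}(m+1)[\omega_{j-m}^n]\right).$$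 -/

import Mathlib

namespace TensorGrowth

open scoped TensorProduct

/-- The relators of `⟨a, b ∣ a ^ p ^ k = b ^ p ^ j = 1, b a b⁻¹ = a ^ (p ^ (k - j) + 1)⟩`, where
`a` and `b` are the free generators with index `0` and `1`. -/
def metacyclicRels (p k j : ℕ) : Set (FreeGroup (Fin 2)) :=
  let a : FreeGroup (Fin 2) := FreeGroup.of 0
  let b : FreeGroup (Fin 2) := FreeGroup.of 1
  {a ^ p ^ k, b ^ p ^ j, b * a * b⁻¹ * (a ^ (p ^ (k - j) + 1))⁻¹}

/-- The group `C_{p^k} ⋊ C_{p^j}`, given by its presentation. -/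
abbrev MetacyclicGroup (p k j : ℕ) : Type :=
  PresentedGroup (metacyclicRels p k j)

section

variable {G V : Type*} [Group G] [AddCommGroup V] [Module ℂ V]

/-- A representation is indecomposable if it is nonzero and is not the direct sum of two nonzero
subrepresentations. -/
def IsIndecomposable (ρ : Representation ℂ G V) : Prop :=
  Nontrivial V ∧ ∀ A B : Subrepresentation ρ, IsCompl A B → A = ⊥ ∨ B = ⊥

/-- `ρ` is the internal direct sum of `m` indecomposable subrepresentations. -/
def IsSumOfIndecomposables (ρ : Representation ℂ G V) (m : ℕ) : Prop :=
  ∃ W : Fin m → Subrepresentation ρ,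
    DirectSum.IsInternal (fun i => (W i).toSubmodule) ∧
      ∀ i, IsIndecomposable (W i).toRepresentation

/-- The diagonal action of `G` on the tensor power `V^{⊗n}`. -/
noncomputable def tensorPower (ρ : Representation ℂ G V) (n : ℕ) :
    Representation ℂ G (⨂[ℂ]^n V) where
  toFun g := PiTensorProduct.map fun _ => ρ g
  map_one' := by simp only [map_one, PiTensorProduct.map_one]
  map_mul' g h := by simp only [map_mul, PiTensorProduct.map_mul]

/-- The growth rate `b(n)`: the number of indecomposable summands, counted with multiplicity, in a
decomposition of `V^{⊗n}`. -/
noncomputable def growthRate (ρ : Representation ℂ G V) (n : ℕ) : ℕ :=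
  sInf {m | IsSumOfIndecomposables (tensorPower ρ n) m}

/-- `Z_V(G)`: the elements of `G` that act on `V` by a scalar. -/
def scalarElements (ρ : Representation ℂ G V) : Set G :=
  {g | ∃ c : ℂ, ρ g = c • LinearMap.id}

open Classical in
/-- `ω_V(g)`: the scalar by which `g ∈ Z_V(G)` acts on `V` (and `0` if `g ∉ Z_V(G)`). -/
noncomputable def scalarOf (ρ : Representation ℂ G V) (g : G) : ℂ :=
  if h : ∃ c : ℂ, ρ g = c • LinearMap.id then h.choose else 0

variable (G) in
/-- The irreducible complex characters of `G`. Every finite-dimensional complex representation is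
isomorphic to one on some `ℂ^d`. -/
def irreducibleCharacters : Set (G → ℂ) :=
  {χ | ∃ (d : ℕ) (σ : Representation ℂ G (Fin d → ℂ)), σ.IsIrreducible ∧ σ.character = χ}

/-- The sum of the column of the character table of `G` that belongs to the class of `g`. -/
noncomputable def columnSum (g : G) : ℂ :=
  ∑ᶠ χ ∈ irreducibleCharacters G, χ g

/-- A chosen representative of a conjugacy class. -/
noncomputable def classRep (c : ConjClasses G) : G :=
  Function.surjInv ConjClasses.mk_surjective c

/-- The asymptotic growth rate of a faithful representation `V` of a finite group `G`,
`a(n) = (1 / |G|) ∑_{t : g_t ∈ Z_V(G)} S_t ω_V(g_t)^n (dim V)^n`, where `g_t` runs through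
representatives of the conjugacy classes and `S_t` is the column sum at `g_t⁻¹`. -/
noncomputable def asymptoticGrowthRate (ρ : Representation ℂ G V) (n : ℕ) : ℂ :=
  (1 / (Nat.card G : ℂ)) *
    ∑ᶠ (c : ConjClasses G) (_ : classRep c ∈ scalarElements ρ),
      columnSum (classRep c)⁻¹ * scalarOf ρ (classRep c) ^ n * (Module.finrank ℂ V : ℂ) ^ n

end

/-- `[ω_i^n]`: the sum of the `n`-th powers of the primitive `p^i`-th roots of unity. -/
noncomputable def primitiveRootPowerSum (p i n : ℕ) : ℂ :=
  ∑ ω ∈ primitiveRoots (p ^ i) ℂ, ω ^ n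

end TensorGrowth

namespace TensorGrowth

open scoped TensorProduct MonoidAlgebra
open Module

/-! ### Complete reducibility and Schur's lemma over `ℂ`. -/

section Decomposition

variable {G V : Type*} [Group G] [AddCommGroup V] [Module ℂ V]

/-! The commutator `c = a ^ p ^ (k - j)` of the generators is central because `2 * j ≤ k`, and it
has order `p ^ j`. In an irreducible representation it acts by a scalar `z`, so `a` and `b` commute
up to `z`, and this alone forces the dimension to be `orderOf z` (`finrank_eq_orderOf`). On the
faithful `V` the scalar `ζ` has order `p ^ j`, which is therefore `dim V`. On `V^{⊗n}` it is `ζ ^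
n`, so with `gcd (p ^ j, n) = p ^ v` every irreducible constituent has dimension `D = p ^ (j - v)`,
and `b(n) = p ^ (j * n) / D` for every decomposition.

For `a(n)`, the scalar elements are exactly the centre. Column sums are read off the regular
representation, and orthogonality of central characters keeps only constituents whose central
character is the `n`-th power of that of `V`. These also have dimension `D`, so evaluating the
regular character gives `|G| / D`, and the factor `|G|` cancels (`asymptoticGrowthRate_eq`).

The closed formula is then arithmetic: the primitive root sums are differences of full root sums,
and the weighted sum telescopes to a geometric series (`growth_formula`). -/

theorem isIrreducible_toRepresentation_of_isAtom {ρ : Representation ℂ G V}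
    {W : Subrepresentation ρ} (hW : IsAtom W) : W.toRepresentation.IsIrreducible := by
  have hne : (⊥ : Subrepresentation W.toRepresentation) ≠ ⊤ := by
    intro h
    apply hW.1
    apply Subrepresentation.toSubmodule_injective
    refine (Submodule.eq_bot_iff _).2 fun x hx => ?_
    have h1 : (⟨x, hx⟩ : W.toSubmodule) ∈
        (⊤ : Subrepresentation W.toRepresentation).toSubmodule := Submodule.mem_top
    rw [← h] at h1
    exact congrArg Subtype.val ((Submodule.mem_bot ℂ).1 h1)
  refine { exists_pair_ne := ⟨⊥, ⊤, hne⟩, eq_bot_or_eq_top := fun A => ?_ }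
  let A' : Subrepresentation ρ :=
    { toSubmodule := A.toSubmodule.map W.toSubmodule.subtype
      apply_mem_toSubmodule := by
        rintro g _ ⟨x, hx, rfl⟩
        exact ⟨W.toRepresentation g x, A.apply_mem_toSubmodule g hx, rfl⟩ }
  have hA' : A' ≤ W := by
    rintro _ ⟨x, -, rfl⟩
    exact x.2
  rcases hW.le_iff.1 hA' with h | h
  · left
    apply Subrepresentation.toSubmodule_injective
    have h1 : A.toSubmodule.map W.toSubmodule.subtype = ⊥ :=
      congrArg Subrepresentation.toSubmodule h
    exact Submodule.map_injective_of_injective (Submodule.subtype_injective _)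
      (h1.trans (Submodule.map_bot _).symm)
  · right
    apply Subrepresentation.toSubmodule_injective
    have h1 : A.toSubmodule.map W.toSubmodule.subtype = W.toSubmodule :=
      congrArg Subrepresentation.toSubmodule h
    refine (Submodule.eq_top_iff').2 fun x => ?_
    have h2 : (x : V) ∈ A.toSubmodule.map W.toSubmodule.subtype := by
      rw [h1]
      exact x.2
    obtain ⟨y, hy, hyx⟩ := h2
    exact (Subtype.ext hyx : y = x) ▸ hy

theorem nontrivial_of_isIrreducible {ρ : Representation ℂ G V} (h : ρ.IsIrreducible) :
    Nontrivial V := by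
  by_contra hV
  rw [not_nontrivial_iff_subsingleton] at hV
  exact bot_ne_top (α := Subrepresentation ρ)
    (Subrepresentation.toSubmodule_injective (Subsingleton.elim _ _))

theorem isIndecomposable_of_isIrreducible {ρ : Representation ℂ G V} (h : ρ.IsIrreducible) :
    IsIndecomposable ρ := by
  refine ⟨nontrivial_of_isIrreducible h, fun A B hAB => ?_⟩
  refine (IsSimpleOrder.eq_bot_or_eq_top A).imp_right fun hA => ?_
  simpa [hA] using hAB.inf_eq_bot

/-- Maschke's theorem supplies a complement to every subrepresentation. -/
theorem isIrreducible_of_isIndecomposable [Finite G] {ρ : Representation ℂ G V}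
    (h : IsIndecomposable ρ) : ρ.IsIrreducible := by
  obtain ⟨hV, h⟩ := h
  have hss : ρ.IsSemisimpleRepresentation := by
    have : NeZero (Nat.card G : ℂ) := ⟨Nat.cast_ne_zero.2 Nat.card_pos.ne'⟩
    infer_instance
  refine { exists_pair_ne := ⟨⊥, ⊤, fun h => ?_⟩, eq_bot_or_eq_top := fun A => ?_ }
  · exact bot_ne_top (α := Submodule ℂ V) (congrArg Subrepresentation.toSubmodule h)
  · obtain ⟨B, hB⟩ := exists_isCompl A
    refine (h A B hB).imp_right fun hB' => ?_
    simpa [hB'] using hB.sup_eq_top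

theorem exists_isInternal_isIrreducible [Finite G] [FiniteDimensional ℂ V]
    (ρ : Representation ℂ G V) :
    ∃ (m : ℕ) (W : Fin m → Subrepresentation ρ),
      DirectSum.IsInternal (fun i => (W i).toSubmodule) ∧
        ∀ i, (W i).toRepresentation.IsIrreducible := by
  have : NeZero (Nat.card G : ℂ) := ⟨Nat.cast_ne_zero.2 Nat.card_pos.ne'⟩
  obtain ⟨s, hind, hsup, hsimple⟩ :=
    IsSemisimpleModule.exists_sSupIndep_sSup_simples_eq_top ℂ[G] ρ.asModule
  have hfin : Module.Finite ℂ[G] ρ.asModule := Module.Finite.of_restrictScalars_finite ℂ _ _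
  -- The ascending chain condition bounds an independent family of nonzero submodules.
  have hs : Finite s := WellFoundedGT.finite_of_iSupIndep ((sSupIndep_iff _).mp hind)
    fun i => (isSimpleModule_iff_isAtom.1 (hsimple _ i.2)).1
  obtain ⟨m, ⟨e⟩⟩ := Finite.exists_equiv_fin s
  have hint : DirectSum.IsInternal
      (fun i : Fin m => ((e.symm i : s) : Submodule ℂ[G] ρ.asModule)) := by
    refine DirectSum.isInternal_submodule_of_iSupIndep_of_iSup_eq_top ?_ ?_
    · exact ((sSupIndep_iff _).mp hind).comp e.symm.injective
    · rw [← hsup, sSup_eq_iSup']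
      exact e.symm.iSup_comp (g := fun x : s => (x : Submodule ℂ[G] ρ.asModule))
  refine ⟨m, fun i => Subrepresentation.ofSubmodule' (e.symm i).1, hint, fun i => ?_⟩
  apply isIrreducible_toRepresentation_of_isAtom
  have h1 := isSimpleModule_iff_isAtom.1 (hsimple _ (e.symm i).2)
  exact (OrderIso.isAtom_iff Subrepresentation.subrepresentationSubmoduleOrderIso.symm _).2 h1

theorem character_eq_sum_of_isInternal [FiniteDimensional ℂ V] {ρ : Representation ℂ G V}
    {m : ℕ} {W : Fin m → Subrepresentation ρ}
    (hW : DirectSum.IsInternal (fun i => (W i).toSubmodule)) (g : G) :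
    ρ.character g = ∑ i, (W i).toRepresentation.character g :=
  LinearMap.trace_eq_sum_trace_restrict hW fun i => (W i).apply_mem_toSubmodule g

theorem finrank_eq_sum_of_isInternal [FiniteDimensional ℂ V] {ρ : Representation ℂ G V}
    {m : ℕ} {W : Fin m → Subrepresentation ρ}
    (hW : DirectSum.IsInternal (fun i => (W i).toSubmodule)) :
    finrank ℂ V = ∑ i, finrank ℂ (W i).toSubmodule := by
  have h := character_eq_sum_of_isInternal hW 1
  simp only [Representation.char_one] at h
  exact_mod_cast h

theorem exists_isSumOfIndecomposables [Finite G] [FiniteDimensional ℂ V]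
    (ρ : Representation ℂ G V) : ∃ m, IsSumOfIndecomposables ρ m := by
  obtain ⟨m, W, hW, hirr⟩ := exists_isInternal_isIrreducible ρ
  exact ⟨m, W, hW, fun i => isIndecomposable_of_isIrreducible (hirr i)⟩

/-- If all irreducible subrepresentations of `ρ` have dimension `D`, then every decomposition into
indecomposables has `dim V / D` summands. -/
theorem isSumOfIndecomposables_iff [Finite G] [FiniteDimensional ℂ V]
    {ρ : Representation ℂ G V} {D : ℕ} (hD : 0 < D)
    (h : ∀ W : Subrepresentation ρ, W.toRepresentation.IsIrreducible →
      finrank ℂ W.toSubmodule = D) (m : ℕ) :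
    IsSumOfIndecomposables ρ m ↔ m * D = finrank ℂ V := by
  have key : ∀ m, IsSumOfIndecomposables ρ m → m * D = finrank ℂ V := by
    rintro m ⟨W, hW, hirr⟩
    rw [finrank_eq_sum_of_isInternal hW,
      Finset.sum_congr rfl fun i _ => h _ (isIrreducible_of_isIndecomposable (hirr i))]
    simp
  refine ⟨key m, fun hm => ?_⟩
  obtain ⟨m', h1⟩ := exists_isSumOfIndecomposables ρ
  have h2 : m = m' := Nat.eq_of_mul_eq_mul_right hD (hm.trans (key m' h1).symm)
  exact h2 ▸ h1

theorem exists_scalar_of_commute [FiniteDimensional ℂ V] {ρ : Representation ℂ G V}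
    (hρ : ρ.IsIrreducible) {T : End ℂ V} (hT : ∀ g, Commute T (ρ g)) :
    ∃ c : ℂ, T = c • LinearMap.id := by
  obtain ⟨c, hc⟩ :=
    (Representation.IsIrreducible.algebraMap_intertwiningMap_bijective_of_isAlgClosed
      (ρ := ρ)).2 ⟨T, fun g => hT g⟩
  exact ⟨c, (congrArg Representation.IntertwiningMap.toLinearMap hc).symm⟩

theorem exists_scalar_of_mem_center [FiniteDimensional ℂ V] {ρ : Representation ℂ G V}
    (hρ : ρ.IsIrreducible) {z : G} (hz : z ∈ Subgroup.center G) :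
    ∃ c : ℂ, ρ z = c • LinearMap.id :=
  exists_scalar_of_commute hρ fun g =>
    Commute.map (f := ρ) (Subgroup.mem_center_iff.1 hz g).symm

theorem exists_centralCharacter [FiniteDimensional ℂ V] {ρ : Representation ℂ G V}
    (hρ : ρ.IsIrreducible) :
    ∃ μ : Subgroup.center G →* ℂ, ∀ z : Subgroup.center G, ρ z = μ z • LinearMap.id := by
  have := nontrivial_of_isIrreducible hρ
  choose μ hμ using fun z : Subgroup.center G => exists_scalar_of_mem_center hρ z.2
  have hinj : Function.Injective fun c : ℂ => c • (LinearMap.id : V →ₗ[ℂ] V) :=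
    smul_left_injective ℂ (one_ne_zero (α := Module.End ℂ V))
  refine ⟨{ toFun := μ, map_one' := hinj ?_, map_mul' := fun x y => hinj ?_ }, hμ⟩
  · simp [← hμ, Module.End.one_eq_id]
  · simp only [← hμ, Subgroup.coe_mul, map_mul]
    rw [hμ x, hμ y]
    ext v
    simp [mul_smul, smul_comm (μ x) (μ y)]

end Decomposition

/-! ### Column sums of the character table via the regular representation. -/

section ColumnSum

variable {G : Type*} [Group G]

theorem character_leftRegular [Finite G] (g : G) [Decidable (g = 1)] :
    (Representation.leftRegular ℂ G).character g = if g = 1 then (Nat.card G : ℂ) else 0 := by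
  classical
  have := Fintype.ofFinite G
  rw [Representation.character, LinearMap.trace_eq_matrix_trace ℂ (MonoidAlgebra.basis G ℂ),
    Matrix.trace]
  have h : ∀ x : G, (LinearMap.toMatrix (MonoidAlgebra.basis G ℂ) (MonoidAlgebra.basis G ℂ)
      (Representation.leftRegular ℂ G g)).diag x = if g = 1 then 1 else 0 := by
    intro x
    rw [Matrix.diag_apply, LinearMap.toMatrix_apply]
    simp [MonoidAlgebra.basis, Finsupp.single_apply]
  rw [Finset.sum_congr rfl fun x _ => h x]
  split_ifs <;> simp

theorem character_mem_irreducibleCharacters {V : Type*} [AddCommGroup V] [Module ℂ V]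
    [FiniteDimensional ℂ V] {ρ : Representation ℂ G V} (h : ρ.IsIrreducible) :
    ρ.character ∈ irreducibleCharacters G := by
  let e : V ≃ₗ[ℂ] (Fin (finrank ℂ V) → ℂ) := (finBasis ℂ V).equivFun
  let σ : Representation ℂ G (Fin (finrank ℂ V) → ℂ) :=
    (e.conjAlgEquiv ℂ : End ℂ V →* End ℂ (Fin (finrank ℂ V) → ℂ)).comp ρ
  let φ : ρ.Equiv σ := Representation.Equiv.mk e fun g => by
    ext v
    simp [σ]
  refine ⟨_, σ, ?_, (Representation.char_iso φ).symm⟩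
  have hρ := (Representation.irreducible_iff_isSimpleModule_asModule ρ).1 h
  rw [Representation.irreducible_iff_isSimpleModule_asModule]
  exact IsSimpleModule.congr (LinearEquiv.ofBijective
    (Representation.IntertwiningMap.equivLinearMapAsModule ρ σ φ.toIntertwiningMap)
    e.bijective).symm

variable [Finite G] {m : ℕ} {W : Fin m → Subrepresentation (Representation.leftRegular ℂ G)}

/-- An irreducible character occurs in the regular representation as often as its degree says. -/
theorem card_filter_character_eq
    (hW : DirectSum.IsInternal (fun i => (W i).toSubmodule))
    (hirr : ∀ i, (W i).toRepresentation.IsIrreducible)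
    {V : Type*} [AddCommGroup V] [Module ℂ V] [FiniteDimensional ℂ V]
    {σ : Representation ℂ G V} (hσ : σ.IsIrreducible)
    [DecidablePred fun i => (W i).toRepresentation.character = σ.character] :
    (Finset.univ.filter fun i => (W i).toRepresentation.character = σ.character).card =
      finrank ℂ V := by
  classical
  have := Fintype.ofFinite G
  have hne : (Nat.card G : ℂ) ≠ 0 := Nat.cast_ne_zero.2 Nat.card_pos.ne'
  have : Invertible (Nat.card G : ℂ) := invertibleOfNonzero hne
  have h1 := Representation.card_inv_mul_sum_char_mul_char_eq_finrank
    (Representation.leftRegular ℂ G) σ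
  rw [(Representation.leftRegularMapEquiv σ).finrank_eq] at h1
  have h2 : ∀ i, (Nat.card G : ℂ)⁻¹ *
      ∑ g : G, σ.character g * (W i).toRepresentation.character g⁻¹ =
        if (W i).toRepresentation.character = σ.character then 1 else 0 := by
    intro i
    have := hirr i
    have h := Representation.char_orthonormal σ (W i).toRepresentation
    rw [h]
    congr 1
    apply propext
    refine ⟨fun ⟨φ⟩ => Representation.char_iso φ, fun hc => ?_⟩
    -- Equal characters force an isomorphism: otherwise the norm of `σ.character` would be both 0
    -- and 1.
    by_contra hemp
    have h' := Representation.char_orthonormal σ σ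
    rw [hc] at h
    rw [h, if_neg hemp, if_pos ⟨Representation.Equiv.refl σ⟩] at h'
    exact zero_ne_one h'
  have h3 : ∑ g : G, σ.character g * (Representation.leftRegular ℂ G).character g⁻¹ =
      ∑ i, ∑ g : G, σ.character g * (W i).toRepresentation.character g⁻¹ := by
    rw [Finset.sum_comm]
    refine Finset.sum_congr rfl fun g _ => ?_
    rw [character_eq_sum_of_isInternal hW, Finset.mul_sum]
  rw [h3, Finset.mul_sum, Finset.sum_congr rfl fun i _ => h2 i, Finset.sum_boole] at h1
  exact_mod_cast h1

/-- A character of degree `d` occurs `d` times in the regular representation, so dividing by `d`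
counts it exactly once. -/
theorem columnSum_eq_sum_div
    (hW : DirectSum.IsInternal (fun i => (W i).toSubmodule))
    (hirr : ∀ i, (W i).toRepresentation.IsIrreducible) (g : G) :
    columnSum g = ∑ i, (W i).toRepresentation.character g / finrank ℂ (W i).toSubmodule := by
  classical
  have himage : irreducibleCharacters G =
      (Finset.univ.image fun i => (W i).toRepresentation.character : Finset (G → ℂ)) := by
    ext χ
    simp only [Finset.coe_image, Finset.coe_univ, Set.image_univ, Set.mem_range]
    constructor
    · rintro ⟨d, σ, hσ, rfl⟩
      have hcard := card_filter_character_eq hW hirr hσ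
      have := nontrivial_of_isIrreducible hσ
      obtain ⟨i, hi⟩ := Finset.card_pos.1 (hcard.symm ▸ finrank_pos)
      exact ⟨i, (Finset.mem_filter.1 hi).2⟩
    · rintro ⟨i, rfl⟩
      exact character_mem_irreducibleCharacters (hirr i)
  rw [columnSum, himage, finsum_mem_coe_finset]
  have h := Finset.sum_comp (s := Finset.univ) (fun χ : G → ℂ => χ g / χ 1)
    (fun i => (W i).toRepresentation.character)
  simp only [Representation.char_one] at h
  rw [h]
  refine Finset.sum_congr rfl fun χ hχ => ?_
  obtain ⟨i, -, rfl⟩ := Finset.mem_image.1 hχ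
  rw [card_filter_character_eq hW hirr (hirr i), nsmul_eq_mul, Representation.char_one,
    mul_div_cancel₀]
  have := nontrivial_of_isIrreducible (hirr i)
  exact Nat.cast_ne_zero.2 finrank_pos.ne'

end ColumnSum

/-! ### The asymptotic growth rate through central characters. -/

section AsymptoticGrowth

variable {G V : Type*} [Group G] [AddCommGroup V] [Module ℂ V]

theorem scalarElements_eq_center [FiniteDimensional ℂ V] {ρ : Representation ℂ G V}
    (hirr : ρ.IsIrreducible) (hfaithful : Function.Injective ρ) :
    scalarElements ρ = Subgroup.center G := by
  ext g
  refine ⟨fun ⟨c, hc⟩ => Subgroup.mem_center_iff.2 fun h => hfaithful ?_,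
    fun hg => exists_scalar_of_mem_center hirr hg⟩
  ext v
  simp [hc]

theorem scalarOf_eq [Nontrivial V] {ρ : Representation ℂ G V} {g : G} {c : ℂ}
    (h : ρ g = c • LinearMap.id) : scalarOf ρ g = c := by
  have hex : ∃ c : ℂ, ρ g = c • LinearMap.id := ⟨c, h⟩
  rw [scalarOf, dif_pos hex]
  exact smul_left_injective ℂ (one_ne_zero (α := Module.End ℂ V)) (hex.choose_spec.symm.trans h)

/-- Central classes are singletons, so a sum over representatives lying in the centre is a sum over
the centre itself. -/
theorem bijOn_classRep_center :
    Set.BijOn classRep {c : ConjClasses G | classRep c ∈ Subgroup.center G}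
      (Subgroup.center G) := by
  have hmk : ∀ c : ConjClasses G, ConjClasses.mk (classRep c) = c :=
    Function.surjInv_eq ConjClasses.mk_surjective
  refine ⟨fun c hc => hc, fun c _ d _ h => ?_, fun z hz => ?_⟩
  · rw [← hmk c, h, hmk]
  · have h : IsConj z (classRep (ConjClasses.mk z)) :=
      ConjClasses.mk_eq_mk_iff_isConj.1 (hmk _).symm
    obtain ⟨x, hx⟩ := isConj_iff.1 h
    have hzz : classRep (ConjClasses.mk z) = z := by
      rw [← hx, Subgroup.mem_center_iff.1 hz x, mul_inv_cancel_right]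
    exact ⟨ConjClasses.mk z, by simpa [hzz] using hz, hzz⟩

/-- If every irreducible representation on which the centre acts as on `V^{⊗n}` has dimension `D`,
then the asymptotic growth rate of `V` is `(dim V)^n / D`. -/
theorem asymptoticGrowthRate_eq [Finite G] [FiniteDimensional ℂ V] {ρ : Representation ℂ G V}
    (hirr : ρ.IsIrreducible) (hfaithful : Function.Injective ρ) (n : ℕ) {D : ℕ} (hD : 0 < D)
    (h : ∀ W : Subrepresentation (Representation.leftRegular ℂ G),
      W.toRepresentation.IsIrreducible →
      (∀ z ∈ Subgroup.center G, ∀ c : ℂ, ρ z = c • LinearMap.id →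
        W.toRepresentation z = c ^ n • LinearMap.id) → finrank ℂ W.toSubmodule = D) :
    asymptoticGrowthRate ρ n = (finrank ℂ V : ℂ) ^ n / D := by
  classical
  have hV := nontrivial_of_isIrreducible hirr
  have := Fintype.ofFinite G
  have hD' : (D : ℂ) ≠ 0 := Nat.cast_ne_zero.2 hD.ne'
  have hne : (Nat.card G : ℂ) ≠ 0 := Nat.cast_ne_zero.2 Nat.card_pos.ne'
  obtain ⟨lam, hlam⟩ := exists_centralCharacter hirr
  obtain ⟨m, W, hW, hWirr⟩ := exists_isInternal_isIrreducible (Representation.leftRegular ℂ G)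
  choose μ hμ using fun i => exists_centralCharacter (hWirr i)
  have hchar : ∀ i (z : Subgroup.center G),
      (W i).toRepresentation.character z = μ i z * finrank ℂ (W i).toSubmodule := by
    intro i z
    rw [Representation.character, hμ, map_smul, LinearMap.trace_id, smul_eq_mul]
  have hfin : ∀ i, (finrank ℂ (W i).toSubmodule : ℂ) ≠ 0 := fun i =>
    have := nontrivial_of_isIrreducible (hWirr i)
    Nat.cast_ne_zero.2 finrank_pos.ne'
  -- The sum vanishes unless the central character of `W i` is `lam ^ n`, and then `W i` has
  -- dimension `D`; either way `D` may be exchanged for the true dimension.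
  have horth : ∀ i, (∑ z : Subgroup.center G, lam z ^ n * μ i z⁻¹) * D =
      (∑ z : Subgroup.center G, lam z ^ n * μ i z⁻¹) * finrank ℂ (W i).toSubmodule := by
    intro i
    let θ : Subgroup.center G →* ℂ :=
      { toFun := fun z => lam z ^ n * μ i z⁻¹
        map_one' := by simp
        map_mul' := fun x y => by
          rw [mul_inv_rev, map_mul, map_mul, mul_pow]
          ring }
    by_cases hi : θ = 1
    · rw [h (W i) (hWirr i)]
      intro z hz c hc
      have h1 : lam ⟨z, hz⟩ = c := by
        rw [← scalarOf_eq hc, scalarOf_eq (hlam ⟨z, hz⟩)]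
      have h2 : lam ⟨z, hz⟩ ^ n * μ i (⟨z, hz⟩ : Subgroup.center G)⁻¹ = 1 :=
        DFunLike.congr_fun hi ⟨z, hz⟩
      have h3 : μ i (⟨z, hz⟩ : Subgroup.center G)⁻¹ * μ i ⟨z, hz⟩ = 1 := by
        rw [← map_mul, inv_mul_cancel, map_one]
      have h4 : μ i ⟨z, hz⟩ = c ^ n := by
        rw [← h1]
        calc μ i ⟨z, hz⟩ = (lam ⟨z, hz⟩ ^ n * μ i (⟨z, hz⟩ : Subgroup.center G)⁻¹) *
              μ i ⟨z, hz⟩ := by rw [h2, one_mul]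
          _ = lam ⟨z, hz⟩ ^ n := by rw [mul_assoc, h3, mul_one]
      rw [← h4]
      exact hμ i ⟨z, hz⟩
    · have h0 : ∑ z : Subgroup.center G, lam z ^ n * μ i z⁻¹ = 0 := sum_hom_units_eq_zero θ hi
      rw [h0, zero_mul, zero_mul]
  -- After this exchange the characters of the `W i` add up to the regular character, which vanishes
  -- off the identity.
  have hsum : (∑ z : Subgroup.center G, columnSum (z : G)⁻¹ * lam z ^ n) * D = Nat.card G := by
    calc (∑ z : Subgroup.center G, columnSum (z : G)⁻¹ * lam z ^ n) * D
        = ∑ i, (∑ z : Subgroup.center G, lam z ^ n * μ i z⁻¹) * D := by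
          rw [← Finset.sum_mul, Finset.sum_comm]
          congr 1
          refine Finset.sum_congr rfl fun z _ => ?_
          rw [columnSum_eq_sum_div hW hWirr, Finset.sum_mul]
          refine Finset.sum_congr rfl fun i _ => ?_
          have := hchar i z⁻¹
          rw [Subgroup.coe_inv] at this
          rw [this, mul_div_cancel_right₀ _ (hfin i), mul_comm]
      _ = ∑ z : Subgroup.center G, lam z ^ n *
            (Representation.leftRegular ℂ G).character (z : G)⁻¹ := by
          rw [Finset.sum_congr rfl fun i _ => horth i]
          simp_rw [Finset.sum_mul]
          rw [Finset.sum_comm]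
          refine Finset.sum_congr rfl fun z _ => ?_
          rw [character_eq_sum_of_isInternal hW, Finset.mul_sum]
          refine Finset.sum_congr rfl fun i _ => ?_
          have := hchar i z⁻¹
          rw [Subgroup.coe_inv] at this
          rw [this, mul_assoc]
      _ = Nat.card G := by
          simp_rw [character_leftRegular]
          rw [Finset.sum_eq_single 1]
          · simp
          · intro z _ hz
            simp [hz]
          · simp
  have hconj : asymptoticGrowthRate ρ n = 1 / (Nat.card G : ℂ) *
      ∑ z : Subgroup.center G, columnSum (z : G)⁻¹ * lam z ^ n * (finrank ℂ V : ℂ) ^ n := by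
    rw [asymptoticGrowthRate]
    congr 1
    rw [scalarElements_eq_center hirr hfaithful]
    have h1 := finsum_mem_eq_of_bijOn (f := fun c : ConjClasses G =>
      columnSum (classRep c)⁻¹ * scalarOf ρ (classRep c) ^ n * (finrank ℂ V : ℂ) ^ n)
      (g := fun z : G => columnSum z⁻¹ * scalarOf ρ z ^ n * (finrank ℂ V : ℂ) ^ n)
      classRep (bijOn_classRep_center (G := G)) (fun _ _ => rfl)
    refine h1.trans ?_
    rw [← finsum_set_coe_eq_finsum_mem]
    refine (finsum_eq_sum_of_fintype (α := Subgroup.center G) _).trans ?_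
    refine Finset.sum_congr rfl fun z _ => ?_
    rw [scalarOf_eq (hlam z)]
  rw [hconj, ← Finset.sum_mul]
  field_simp
  rw [← hsum]
  ring

end AsymptoticGrowth

/-! ### Irreducible representations in which the generators commute up to a scalar. -/

section Dimension

variable {G V : Type*} [Group G] [AddCommGroup V] [Module ℂ V]

/-- An irreducible representation of a finite group generated by two elements that commute up to a
scalar `z` has dimension the order of `z`. -/
theorem finrank_eq_orderOf [Finite G] [FiniteDimensional ℂ V] {ρ : Representation ℂ G V}
    (hρ : ρ.IsIrreducible) {a b : G} (hgen : Subgroup.closure {a, b} = ⊤) {z : ℂ}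
    (hz : 0 < orderOf z) (hab : ρ b * ρ a = z • (ρ a * ρ b)) :
    finrank ℂ V = orderOf z := by
  have hV := nontrivial_of_isIrreducible hρ
  -- In a finite group inverses are powers, so closure under products suffices.
  have hind : ∀ P : G → Prop, P 1 → P a → P b → (∀ x y, P x → P y → P (x * y)) → ∀ g, P g := by
    intro P h1 ha hb hmul g
    have hg : g ∈ Subgroup.closure {a, b} := hgen ▸ Subgroup.mem_top g
    induction hg using Subgroup.closure_induction with
    | mem x hx => rcases hx with rfl | rfl <;> assumption
    | one => exact h1
    | mul x y _ _ hx hy => exact hmul x y hx hy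
    | inv x _ hx =>
      have hpow : ∀ r : ℕ, P (x ^ r) := fun r => by
        induction r with
        | zero => simpa using h1
        | succ r ih => rw [pow_succ]; exact hmul _ _ ih hx
      have hinv : x⁻¹ = x ^ (orderOf x - 1) := by
        rw [inv_eq_iff_mul_eq_one, ← pow_succ', Nat.sub_add_cancel (orderOf_pos x),
          pow_orderOf_eq_one]
      exact hinv ▸ hpow _
  have hpow : ∀ t : ℕ, ρ b * ρ a ^ t = z ^ t • (ρ a ^ t * ρ b) := by
    intro t
    induction t with
    | zero => simp
    | succ t ih =>
      rw [pow_succ, ← mul_assoc, ih, smul_mul_assoc, mul_assoc, hab, mul_smul_comm, smul_smul,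
        ← pow_succ, mul_assoc]
  obtain ⟨β, hβ⟩ := End.exists_eigenvalue (ρ b)
  obtain ⟨v, hv⟩ := hβ.exists_hasEigenvector
  have hinj : ∀ g, Function.Injective (ρ g) := fun g => (ρ.apply_bijective g).1
  have hβ0 : β ≠ 0 := by
    rintro rfl
    apply hv.2
    apply hinj b
    rw [hv.apply_eq_smul, zero_smul, map_zero]
  -- Applying `a` multiplies the `b`-eigenvalue by `z`; for `t < orderOf z` the eigenvalues are
  -- distinct, hence the vectors independent.
  have hvec : ∀ t : ℕ, End.HasEigenvector (ρ b) (z ^ t * β) ((ρ a ^ t) v) := by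
    intro t
    rw [End.hasEigenvector_iff, End.mem_eigenspace_iff]
    constructor
    · have := LinearMap.congr_fun (hpow t) v
      simpa [hv.apply_eq_smul, mul_smul] using this
    · rw [← map_pow]
      intro h0
      exact hv.2 (hinj (a ^ t) (h0.trans (map_zero _).symm))
  -- This power of `a` commutes with both generators, so Schur applies; it closes the orbit of `v`
  -- up to scalars, making the span of `u` stable.
  have hscal : ∃ c : ℂ, ρ a ^ orderOf z = c • LinearMap.id := by
    refine exists_scalar_of_commute hρ (hind _ ?_ ?_ ?_ ?_)
    · simp
    · exact Commute.pow_left rfl _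
    · have := hpow (orderOf z)
      rw [pow_orderOf_eq_one, one_smul] at this
      exact this.symm
    · intro x y hx hy
      rw [map_mul]
      exact hx.mul_right hy
  obtain ⟨c, hc⟩ := hscal
  let u : Fin (orderOf z) → V := fun t => (ρ a ^ (t : ℕ)) v
  have hli : LinearIndependent ℂ u := by
    refine End.eigenvectors_linearIndependent' (ρ b) (fun t : Fin (orderOf z) => z ^ (t : ℕ) * β)
      (fun s t hst => ?_) u fun t => hvec t
    exact Fin.ext (pow_injOn_Iio_orderOf s.2 t.2 (mul_right_cancel₀ hβ0 hst))
  have hmem : ∀ t : ℕ, (ρ a ^ t) v ∈ Submodule.span ℂ (Set.range u) := by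
    intro t
    have h1 : (ρ a ^ t) v = c ^ (t / orderOf z) • u ⟨t % orderOf z, Nat.mod_lt _ hz⟩ := by
      have h2 : ρ a ^ t = c ^ (t / orderOf z) • ρ a ^ (t % orderOf z) := by
        conv_lhs => rw [← Nat.mod_add_div t (orderOf z), pow_add, pow_mul, hc]
        rw [smul_pow, ← Module.End.one_eq_id, one_pow, mul_smul_comm, mul_one]
      rw [h2]
      rfl
    rw [h1]
    exact Submodule.smul_mem _ _ (Submodule.subset_span ⟨_, rfl⟩)
  let S : Subrepresentation ρ :=
    { toSubmodule := Submodule.span ℂ (Set.range u)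
      apply_mem_toSubmodule := by
        refine hind _ ?_ ?_ ?_ ?_
        · intro w hw
          simpa using hw
        · intro w hw
          refine (Submodule.span_le (p := (Submodule.span ℂ (Set.range u)).comap (ρ a))).2 ?_ hw
          rintro _ ⟨t, rfl⟩
          have := hmem (t + 1)
          rw [pow_succ'] at this
          exact this
        · intro w hw
          refine (Submodule.span_le (p := (Submodule.span ℂ (Set.range u)).comap (ρ b))).2 ?_ hw
          rintro _ ⟨t, rfl⟩
          have := (hvec t).apply_eq_smul
          rw [SetLike.mem_coe, Submodule.mem_comap, this]
          exact Submodule.smul_mem _ _ (hmem t)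
        · intro x y hx hy w hw
          rw [map_mul]
          exact hx (hy hw) }
  have hS : S = ⊤ := by
    refine (IsSimpleOrder.eq_bot_or_eq_top S).resolve_left fun h => hv.2 ?_
    have h1 : v ∈ S.toSubmodule := hmem 0
    rw [h] at h1
    exact (Submodule.mem_bot ℂ).1 h1
  have hS' : Submodule.span ℂ (Set.range u) = ⊤ := congrArg Subrepresentation.toSubmodule hS
  rw [← finrank_top ℂ V, ← hS', finrank_span_eq_card hli, Fintype.card_fin]

end Dimension

/-! ### Scalars and dimension on tensor powers. -/

section TensorPower

variable {G V : Type*} [Group G] [AddCommGroup V] [Module ℂ V]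

theorem tensorPower_apply_of_scalar {ρ : Representation ℂ G V} {g : G} {c : ℂ}
    (h : ρ g = c • LinearMap.id) (n : ℕ) :
    tensorPower ρ n g = c ^ n • LinearMap.id := by
  change PiTensorProduct.map (fun _ : Fin n => ρ g) = _
  ext x
  have := (PiTensorProduct.tprod ℂ).map_smul_univ (fun _ : Fin n => c) x
  simpa [h] using this

theorem finrank_tensorPower [FiniteDimensional ℂ V] (n : ℕ) :
    finrank ℂ (⨂[ℂ]^n V) = finrank ℂ V ^ n := by
  rw [finrank_eq_card_basis (Basis.piTensorProduct fun _ : Fin n => finBasis ℂ V)]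
  simp

end TensorPower

/-! ### The presented group: finiteness and its central commutator. -/

section Metacyclic

variable (p k j : ℕ)

/-- The generator of the normal cyclic subgroup. -/
abbrev genA : MetacyclicGroup p k j := PresentedGroup.of 0

/-- The generator of the complement. -/
abbrev genB : MetacyclicGroup p k j := PresentedGroup.of 1

theorem genA_pow : genA p k j ^ p ^ k = 1 :=
  PresentedGroup.one_of_mem (rels := metacyclicRels p k j) (x := FreeGroup.of 0 ^ p ^ k)
    (Or.inl rfl)

theorem genB_pow : genB p k j ^ p ^ j = 1 :=
  PresentedGroup.one_of_mem (rels := metacyclicRels p k j) (x := FreeGroup.of 1 ^ p ^ j)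
    (Or.inr (Or.inl rfl))

theorem genB_conj_genA :
    genB p k j * genA p k j * (genB p k j)⁻¹ = genA p k j ^ (p ^ (k - j) + 1) :=
  mul_inv_eq_one.1 <| PresentedGroup.one_of_mem (rels := metacyclicRels p k j)
    (x := FreeGroup.of 1 * FreeGroup.of 0 * (FreeGroup.of 1)⁻¹ *
      (FreeGroup.of 0 ^ (p ^ (k - j) + 1))⁻¹) (Or.inr (Or.inr rfl))

theorem closure_genA_genB : Subgroup.closure {genA p k j, genB p k j} = ⊤ := by
  rw [← PresentedGroup.closure_range_of]
  congr 1
  ext x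
  simp [Fin.exists_fin_two, eq_comm]

theorem genB_mul_genA_pow (s : ℕ) :
    genB p k j * genA p k j ^ s = genA p k j ^ ((p ^ (k - j) + 1) * s) * genB p k j := by
  rw [pow_mul, ← genB_conj_genA, conj_pow, inv_mul_cancel_right]

theorem exists_eq_genA_pow_mul_genB_pow {p : ℕ} (hp : 0 < p) (g : MetacyclicGroup p k j) :
    ∃ s t : ℕ, g = genA p k j ^ s * genB p k j ^ t := by
  have hcomm : ∀ t s : ℕ, ∃ s' : ℕ,
      genB p k j ^ t * genA p k j ^ s = genA p k j ^ s' * genB p k j ^ t := by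
    intro t
    induction t with
    | zero => exact fun s => ⟨s, by simp⟩
    | succ t ih =>
      intro s
      obtain ⟨s', hs'⟩ := ih ((p ^ (k - j) + 1) * s)
      exact ⟨s', by rw [pow_succ, mul_assoc, genB_mul_genA_pow, ← mul_assoc, hs', mul_assoc]⟩
  have hg : g ∈ Subgroup.closure {genA p k j, genB p k j} :=
    closure_genA_genB p k j ▸ Subgroup.mem_top g
  induction hg using Subgroup.closure_induction with
  | mem x hx =>
    rcases hx with rfl | rfl
    · exact ⟨1, 0, by simp⟩
    · exact ⟨0, 1, by simp⟩
  | one => exact ⟨0, 0, by simp⟩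
  | mul x y _ _ hx hy =>
    obtain ⟨s, t, rfl⟩ := hx
    obtain ⟨s', t', rfl⟩ := hy
    obtain ⟨r, hr⟩ := hcomm t s'
    refine ⟨s + r, t + t', ?_⟩
    rw [pow_add, pow_add, mul_assoc, ← mul_assoc (genB p k j ^ t), hr]
    simp only [mul_assoc]
  | inv x _ hx =>
    obtain ⟨s, t, rfl⟩ := hx
    have hinv : ∀ {N : ℕ} (x : MetacyclicGroup p k j) (s : ℕ), 0 < N → x ^ N = 1 →
        (x ^ s)⁻¹ = x ^ ((N - 1) * s) := by
      intro N x s hN hx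
      rw [inv_eq_iff_mul_eq_one, ← pow_add, add_comm, ← Nat.succ_mul, Nat.succ_eq_add_one,
        Nat.sub_add_cancel hN, pow_mul, hx, one_pow]
    obtain ⟨r, hr⟩ := hcomm ((p ^ j - 1) * t) ((p ^ k - 1) * s)
    refine ⟨r, (p ^ j - 1) * t, ?_⟩
    rw [mul_inv_rev, hinv _ s (pow_pos hp k) (genA_pow p k j),
      hinv _ t (pow_pos hp j) (genB_pow p k j), hr]

theorem finite_metacyclicGroup {p : ℕ} (hp : 0 < p) : Finite (MetacyclicGroup p k j) := by
  refine Finite.of_surjective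
    (fun x : Fin (p ^ k) × Fin (p ^ j) => genA p k j ^ (x.1 : ℕ) * genB p k j ^ (x.2 : ℕ)) ?_
  intro g
  obtain ⟨s, t, rfl⟩ := exists_eq_genA_pow_mul_genB_pow k j hp g
  refine ⟨(⟨s % p ^ k, Nat.mod_lt _ (pow_pos hp k)⟩, ⟨t % p ^ j, Nat.mod_lt _ (pow_pos hp j)⟩), ?_⟩
  dsimp only
  rw [← pow_eq_pow_mod s (genA_pow p k j), ← pow_eq_pow_mod t (genB_pow p k j)]

/-- The commutator of the two generators. -/
abbrev genC : MetacyclicGroup p k j := genA p k j ^ p ^ (k - j)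

theorem genB_mul_genA : genB p k j * genA p k j = genC p k j * genA p k j * genB p k j := by
  have := genB_mul_genA_pow p k j 1
  rwa [pow_one, mul_one, pow_succ] at this

variable {j k}

theorem genC_mem_center (hkj : 2 * j ≤ k) :
    genC p k j ∈ Subgroup.center (MetacyclicGroup p k j) := by
  have hle : Subgroup.closure {genA p k j, genB p k j} ≤ Subgroup.centralizer {genC p k j} := by
    rw [Subgroup.closure_le]
    rintro x (rfl | rfl)
    · rw [SetLike.mem_coe, Subgroup.mem_centralizer_singleton_iff]
      exact (Commute.self_pow _ _).eq
    · rw [SetLike.mem_coe, Subgroup.mem_centralizer_singleton_iff, genB_mul_genA_pow]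
      congr 1
      -- Conjugation by `b` adds `p ^ (2 * (k - j))` to the exponent of `genC`; this is a multiple
      -- of `p ^ k` because `2 * j ≤ k`.
      have h1 : p ^ (k - j) * p ^ (k - j) = p ^ k * p ^ (k - 2 * j) := by
        rw [← pow_add, ← pow_add]
        congr 1
        omega
      rw [add_mul, h1, one_mul, pow_add, pow_mul, genA_pow, one_pow, one_mul]
  rw [Subgroup.mem_center_iff]
  intro g
  have hg : g ∈ Subgroup.closure {genA p k j, genB p k j} :=
    closure_genA_genB p k j ▸ Subgroup.mem_top g
  exact Subgroup.mem_centralizer_singleton_iff.1 (hle hg)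

theorem one_add_pow_of_sq_eq_zero {R : Type*} [CommRing R] {x : R} (hx : x * x = 0) (m : ℕ) :
    (1 + x) ^ m = 1 + m * x := by
  induction m with
  | zero => simp
  | succ m ih =>
    rw [pow_succ, ih]
    push_cast
    linear_combination (m : R) * hx

/-- The relators only bound the order from above. The lower bound comes from an action on `ZMod (p ^
k)` by affine maps: `a` translates by 1 and `b` multiplies by the unit `1 + p ^ (k - j)`. -/
theorem orderOf_genA (hkj : 2 * j ≤ k) : orderOf (genA p k j) = p ^ k := by
  set x : ZMod (p ^ k) := (p : ZMod (p ^ k)) ^ (k - j) with hx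
  have hpk : (p : ZMod (p ^ k)) ^ k = 0 := by
    rw [← Nat.cast_pow, ZMod.natCast_self]
  have hxx : x * x = 0 := by
    rw [hx, ← pow_add, show k - j + (k - j) = k + (k - 2 * j) by omega, pow_add, hpk, zero_mul]
  let u : (ZMod (p ^ k))ˣ :=
    { val := 1 + x
      inv := 1 - x
      val_inv := by linear_combination -hxx
      inv_val := by linear_combination -hxx }
  have hu : u ^ p ^ j = 1 := by
    apply Units.ext
    rw [Units.val_pow_eq_pow_val, one_add_pow_of_sq_eq_zero hxx, Nat.cast_pow, hx, ← pow_add,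
      show j + (k - j) = k by omega, hpk, add_zero, Units.val_one]
  have hadd : ∀ (m : ℕ) (y : ZMod (p ^ k)),
      ((Equiv.addRight (1 : ZMod (p ^ k)) : Equiv.Perm _) ^ m) y = y + m := by
    intro m y
    induction m generalizing y with
    | zero => simp
    | succ m ih =>
      rw [pow_succ, Equiv.Perm.mul_apply, ih, Equiv.coe_addRight]
      push_cast
      ring
  have hmul : ∀ (m : ℕ), (Units.mulLeft u) ^ m = Units.mulLeft (u ^ m) := by
    intro m
    induction m with
    | zero =>
      ext y
      simp
    | succ m ih =>
      rw [pow_succ, ih, pow_succ]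
      ext y
      simp [mul_assoc]
  let f : Fin 2 → Equiv.Perm (ZMod (p ^ k)) := ![Equiv.addRight 1, Units.mulLeft u]
  have hf : ∀ r ∈ metacyclicRels p k j, FreeGroup.lift f r = 1 := by
    rintro r (rfl | rfl | rfl)
    · simp only [map_pow, FreeGroup.lift_apply_of]
      change Equiv.addRight (1 : ZMod (p ^ k)) ^ p ^ k = 1
      ext y
      rw [hadd, Nat.cast_pow, hpk, add_zero, Equiv.Perm.one_apply]
    · simp only [map_pow, FreeGroup.lift_apply_of]
      change (Units.mulLeft u) ^ p ^ j = 1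
      rw [hmul, hu]
      ext y
      simp
    · simp only [map_mul, map_inv, map_pow, FreeGroup.lift_apply_of]
      change Units.mulLeft u * Equiv.addRight 1 * (Units.mulLeft u)⁻¹ *
        (Equiv.addRight 1 ^ (p ^ (k - j) + 1))⁻¹ = 1
      rw [mul_inv_eq_one, mul_inv_eq_iff_eq_mul]
      ext y
      simp only [Equiv.Perm.mul_apply, hadd, Equiv.coe_addRight, Units.mulLeft_apply]
      push_cast
      rw [← hx]
      change (1 + x) * (y + 1) = (1 + x) * y + (x + 1)
      ring
  refine Nat.dvd_antisymm (orderOf_dvd_of_pow_eq_one (genA_pow p k j)) ?_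
  have h1 := congrArg (PresentedGroup.toGroup hf) (pow_orderOf_eq_one (genA p k j))
  rw [map_pow, PresentedGroup.toGroup.of, map_one] at h1
  -- The `m`-th power of the translation sends 0 to `m`.
  have h2 : ((Equiv.addRight (1 : ZMod (p ^ k)) : Equiv.Perm _) ^ orderOf (genA p k j)) 0 = 0 :=
    DFunLike.congr_fun h1 0
  rw [hadd, zero_add] at h2
  exact (ZMod.natCast_eq_zero_iff _ _).1 h2

theorem orderOf_genC (hpos : 0 < p) (hkj : 2 * j ≤ k) : orderOf (genC p k j) = p ^ j := by
  rw [orderOf_pow_of_dvd (pow_pos hpos _).ne', orderOf_genA p hkj,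
    Nat.pow_div (by omega) hpos]
  · congr 1
    omega
  · rw [orderOf_genA p hkj]
    exact pow_dvd_pow p (by omega)

variable {V : Type*} [AddCommGroup V] [Module ℂ V]

theorem orderOf_eq_of_scalar [Nontrivial V] {T : End ℂ V} {z : ℂ} (h : T = z • LinearMap.id) :
    orderOf z = orderOf T := by
  have h1 : T = algebraMap ℂ (End ℂ V) z := h
  rw [h1]
  exact (orderOf_injective (algebraMap ℂ (End ℂ V)).toMonoidHom
    (FaithfulSMul.algebraMap_injective ℂ (End ℂ V)) z).symm

theorem finrank_eq_orderOf_genC [FiniteDimensional ℂ V] {p : ℕ} (hp : 0 < p)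
    {σ : Representation ℂ (MetacyclicGroup p k j) V} (hσ : σ.IsIrreducible) {z : ℂ}
    (hz : σ (genC p k j) = z • LinearMap.id) : finrank ℂ V = orderOf z := by
  have := finite_metacyclicGroup k j hp
  have := nontrivial_of_isIrreducible hσ
  refine finrank_eq_orderOf hσ (closure_genA_genB p k j) ?_ ?_
  · rw [orderOf_eq_of_scalar hz]
    exact (σ.isOfFinOrder (isOfFinOrder_of_finite (genC p k j))).orderOf_pos
  · rw [← map_mul, genB_mul_genA, map_mul, map_mul, hz, mul_assoc, smul_mul_assoc,
      ← Module.End.one_eq_id, one_mul]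

end Metacyclic

/-! ### Power sums of roots of unity and the closed formula. -/

section Arithmetic

theorem sum_nthRootsFinset_pow {N : ℕ} (hN : 0 < N) (n : ℕ) :
    ∑ ω ∈ Polynomial.nthRootsFinset N (1 : ℂ), ω ^ n = if N ∣ n then (N : ℂ) else 0 := by
  have hζ := Complex.isPrimitiveRoot_exp N hN.ne'
  set ζ := Complex.exp (2 * Real.pi * Complex.I / N)
  have : NeZero N := ⟨hN.ne'⟩
  have h1 : ∑ ω ∈ Polynomial.nthRootsFinset N (1 : ℂ), ω ^ n =
      ∑ i ∈ Finset.range N, (ζ ^ n) ^ i := by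
    symm
    refine Finset.sum_nbij (fun i => ζ ^ i) ?_ ?_ ?_ ?_
    · intro i _
      rw [Polynomial.mem_nthRootsFinset hN, pow_right_comm, hζ.pow_eq_one, one_pow]
    · intro i hi l hl hil
      exact hζ.pow_inj (Finset.mem_range.1 hi) (Finset.mem_range.1 hl) hil
    · intro ω hω
      obtain ⟨i, hi, hiω⟩ := hζ.eq_pow_of_pow_eq_one ((Polynomial.mem_nthRootsFinset hN _).1 hω)
      exact ⟨i, Finset.mem_coe.2 (Finset.mem_range.2 hi), hiω⟩
    · intro i _
      exact pow_right_comm _ _ _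
  rw [h1]
  split_ifs with h
  · rw [(hζ.pow_eq_one_iff_dvd n).2 h]
    simp
  · have hne : ζ ^ n - 1 ≠ 0 := sub_ne_zero.2 fun h' => h ((hζ.pow_eq_one_iff_dvd n).1 h')
    refine (mul_eq_zero.1 ?_).resolve_left hne
    rw [mul_geom_sum, pow_right_comm, hζ.pow_eq_one, one_pow, sub_self]

/-- The primitive `p ^ (r + 1)`-th roots are the `p ^ (r + 1)`-th roots that are not `p ^ r`-th
roots. -/
theorem primitiveRootPowerSum_succ {p : ℕ} (hp : p.Prime) (r n : ℕ) :
    primitiveRootPowerSum p (r + 1) n =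
      (if p ^ (r + 1) ∣ n then (p : ℂ) ^ (r + 1) else 0) -
        if p ^ r ∣ n then (p : ℂ) ^ r else 0 := by
  classical
  have hpos : ∀ s, 0 < p ^ s := fun s => pow_pos hp.pos s
  have := Fact.mk hp
  have hsub : Polynomial.nthRootsFinset (p ^ r) (1 : ℂ) ⊆
      Polynomial.nthRootsFinset (p ^ (r + 1)) (1 : ℂ) := by
    intro ω hω
    rw [Polynomial.mem_nthRootsFinset (hpos _)] at hω ⊢
    rw [pow_succ, pow_mul, hω, one_pow]
  have hset : primitiveRoots (p ^ (r + 1)) ℂ =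
      Polynomial.nthRootsFinset (p ^ (r + 1)) (1 : ℂ) \
        Polynomial.nthRootsFinset (p ^ r) (1 : ℂ) := by
    ext ω
    rw [Finset.mem_sdiff, mem_primitiveRoots (hpos _), Polynomial.mem_nthRootsFinset (hpos _),
      Polynomial.mem_nthRootsFinset (hpos _)]
    refine ⟨fun h => ⟨h.pow_eq_one, ?_⟩, fun ⟨h1, h2⟩ => ?_⟩
    · exact h.pow_ne_one_of_pos_of_lt (hpos _).ne' (Nat.pow_lt_pow_right hp.one_lt r.lt_succ_self)
    · rw [IsPrimitiveRoot.iff_orderOf]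
      exact orderOf_eq_prime_pow h2 h1
  rw [primitiveRootPowerSum, hset, Finset.sum_sdiff_eq_sub hsub,
    sum_nthRootsFinset_pow (hpos _), sum_nthRootsFinset_pow (hpos _)]
  push_cast
  rfl

/-- Summation by parts: for `m < j` the value `A (j - m)` is collected with coefficient `(m + 1) - m
= 1`, and `A 0` with `-j`. -/
theorem sum_range_succ_mul_sub (A : ℕ → ℂ) (j : ℕ) :
    ∑ m ∈ Finset.range j, ((m : ℂ) + 1) * (A (j - m) - A (j - (m + 1))) =
      (∑ r ∈ Finset.range j, A (r + 1)) - j * A 0 := by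
  induction j with
  | zero => simp
  | succ j ih =>
    have htel := Finset.sum_range_sub' (fun m => A (j - m)) j
    rw [Finset.sum_range_succ', Finset.sum_range_succ (fun r => A (r + 1))]
    have hsplit : ∑ m ∈ Finset.range j, (((m + 1 : ℕ) : ℂ) + 1) *
        (A (j + 1 - (m + 1)) - A (j + 1 - (m + 1 + 1))) =
        ∑ m ∈ Finset.range j, ((m : ℂ) + 1) * (A (j - m) - A (j - (m + 1))) +
          ∑ m ∈ Finset.range j, (A (j - m) - A (j - (m + 1))) := by
      rw [← Finset.sum_add_distrib]
      refine Finset.sum_congr rfl fun m _ => ?_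
      rw [Nat.add_sub_add_right, Nat.add_sub_add_right]
      push_cast
      ring
    rw [hsplit, ih, htel]
    simp only [Nat.sub_zero, Nat.sub_self, zero_add, Nat.add_sub_cancel]
    push_cast
    ring

theorem sum_primitiveRootPowerSum {p : ℕ} (hp : p.Prime) (j n : ℕ) :
    ∑ m ∈ Finset.range j, ((m : ℂ) + 1) * primitiveRootPowerSum p (j - m) n =
      (∑ r ∈ Finset.range j, if p ^ (r + 1) ∣ n then (p : ℂ) ^ (r + 1) else 0) - j := by
  have h := sum_range_succ_mul_sub (fun r => if p ^ r ∣ n then (p : ℂ) ^ r else 0) j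
  simp only [pow_zero, one_dvd, if_true, mul_one] at h
  rw [← h]
  refine Finset.sum_congr rfl fun m hm => ?_
  have hm' : j - m = j - (m + 1) + 1 := by
    have := Finset.mem_range.1 hm
    omega
  rw [hm', primitiveRootPowerSum_succ hp]

theorem growth_formula {p k j v : ℕ} (hp : p.Prime) (hk : 0 < k) {n : ℕ}
    (hv : (p ^ j).gcd n = p ^ v) :
    ((j : ℂ) + 1) * (p : ℂ) ^ k - (j : ℂ) * (p : ℂ) ^ (k - 1) +
      ((p : ℂ) ^ k - (p : ℂ) ^ (k - 1)) *
        ∑ m ∈ Finset.range j, ((m : ℂ) + 1) * primitiveRootPowerSum p (j - m) n =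
      (p : ℂ) ^ (k + v) := by
  have hvj : v ≤ j := (Nat.pow_dvd_pow_iff_le_right hp.one_lt).1 (hv ▸ Nat.gcd_dvd_left _ _)
  have hdvd : ∀ r < j, (p ^ (r + 1) ∣ n ↔ r < v) := by
    intro r hr
    rw [← Nat.succ_le_iff, Nat.succ_eq_add_one, ← Nat.pow_dvd_pow_iff_le_right hp.one_lt, ← hv,
      Nat.dvd_gcd_iff]
    exact ⟨fun h => ⟨pow_dvd_pow p hr, h⟩, fun h => h.2⟩
  have hsum : (∑ r ∈ Finset.range j, if p ^ (r + 1) ∣ n then (p : ℂ) ^ (r + 1) else 0) =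
      p * ∑ r ∈ Finset.range v, (p : ℂ) ^ r := by
    rw [← Finset.sum_filter, Finset.mul_sum]
    refine Finset.sum_congr ?_ fun r _ => pow_succ' _ _
    ext r
    rw [Finset.mem_filter, Finset.mem_range, Finset.mem_range]
    refine ⟨fun h => (hdvd r h.1).1 h.2, fun h => ?_⟩
    have hr : r < j := by omega
    exact ⟨hr, (hdvd r hr).2 h⟩
  have hgeom := mul_geom_sum (p : ℂ) v
  obtain ⟨l, rfl⟩ : ∃ l, k = l + 1 := ⟨k - 1, by omega⟩
  rw [sum_primitiveRootPowerSum hp, hsum, Nat.add_sub_cancel, pow_add, pow_succ]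
  -- The terms with factor `j` cancel; what remains is `p ^ k + p ^ k * (p ^ v - 1)`.
  linear_combination (p : ℂ) ^ l * p * hgeom

end Arithmetic

end TensorGrowth

/-! ### The main theorem. -/

open TensorGrowth Module in
theorem theorem3p5 (p k j : ℕ) (hp : p.Prime) (hj : 0 < j) (hkj : 2 * j ≤ k)
    {V : Type*} [AddCommGroup V] [Module ℂ V] [FiniteDimensional ℂ V]
    (ρ : Representation ℂ (TensorGrowth.MetacyclicGroup p k j) V)
    (hirr : ρ.IsIrreducible) (hfaithful : Function.Injective ρ) :
    Module.finrank ℂ V = p ^ j ∧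
    ∀ n : ℕ,
      -- `b(n)` is well defined: decompositions into indecomposables exist, all of the same length
      (∀ m : ℕ, TensorGrowth.IsSumOfIndecomposables (TensorGrowth.tensorPower ρ n) m ↔
        m = TensorGrowth.growthRate ρ n) ∧
      (TensorGrowth.growthRate ρ n : ℂ) = TensorGrowth.asymptoticGrowthRate ρ n ∧
      TensorGrowth.asymptoticGrowthRate ρ n =
        ((p : ℂ) ^ j) ^ n / (p : ℂ) ^ (k + j) *
          (((j : ℂ) + 1) * (p : ℂ) ^ k - (j : ℂ) * (p : ℂ) ^ (k - 1) +
            ((p : ℂ) ^ k - (p : ℂ) ^ (k - 1)) *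
              ∑ m ∈ Finset.range j,
                ((m : ℂ) + 1) * TensorGrowth.primitiveRootPowerSum p (j - m) n) := by
  have hfin := finite_metacyclicGroup k j hp.pos
  have hV := nontrivial_of_isIrreducible hirr
  have hcz := genC_mem_center p hkj
  obtain ⟨ζ, hζ⟩ := exists_scalar_of_mem_center hirr hcz
  have hord : orderOf ζ = p ^ j := by
    rw [orderOf_eq_of_scalar hζ, ← orderOf_genC p hp.pos hkj]
    exact orderOf_injective ρ hfaithful _
  have hdim : finrank ℂ V = p ^ j := by rw [finrank_eq_orderOf_genC hp.pos hirr hζ, hord]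
  refine ⟨hdim, fun n => ?_⟩
  obtain ⟨v, hvj, hv⟩ := (Nat.dvd_prime_pow hp).1 (Nat.gcd_dvd_left (p ^ j) n)
  have hD : orderOf (ζ ^ n) = p ^ (j - v) := by
    have hfo : IsOfFinOrder ζ := orderOf_pos_iff.1 (hord ▸ pow_pos hp.pos j)
    rw [hfo.orderOf_pow, hord, hv, Nat.pow_div hvj hp.pos]
  have hDpos : 0 < p ^ (j - v) := pow_pos hp.pos _
  have hsum := isSumOfIndecomposables_iff (ρ := tensorPower ρ n) hDpos fun W hW => by
    rw [← hD]
    refine finrank_eq_orderOf_genC hp.pos hW ?_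
    ext w
    exact LinearMap.congr_fun (tensorPower_apply_of_scalar hζ n) w
  have hasym : asymptoticGrowthRate ρ n = (finrank ℂ V : ℂ) ^ n / (p ^ (j - v) : ℕ) :=
    asymptoticGrowthRate_eq hirr hfaithful n hDpos fun W hW hWz => by
      rw [← hD]
      exact finrank_eq_orderOf_genC hp.pos hW (hWz _ hcz ζ hζ)
  rw [finrank_tensorPower, hdim] at hsum
  -- A decomposition exists, so the infimum is attained rather than being the default 0 of an empty
  -- set.
  have hgrowth : IsSumOfIndecomposables (tensorPower ρ n) (growthRate ρ n) :=
    Nat.sInf_mem (exists_isSumOfIndecomposables (tensorPower ρ n))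
  have hmul := (hsum _).1 hgrowth
  have hp0 : (p : ℂ) ≠ 0 := Nat.cast_ne_zero.2 hp.ne_zero
  refine ⟨fun m => ⟨fun hm => ?_, fun hm => hm ▸ hgrowth⟩, ?_, ?_⟩
  · exact Nat.eq_of_mul_eq_mul_right hDpos (((hsum _).1 hm).trans hmul.symm)
  · rw [hasym, hdim, eq_div_iff (Nat.cast_ne_zero.2 hDpos.ne')]
    exact_mod_cast hmul
  · rw [hasym, hdim, growth_formula hp (by omega) hv]
    -- The denominator `p ^ (k + j)` enters only through this identity; the order of the group is
    -- never computed.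
    have h1 : (p : ℂ) ^ (k + j) = (p : ℂ) ^ (k + v) * (p : ℂ) ^ (j - v) := by
      rw [← pow_add]
      congr 1
      omega
    rw [h1]
    push_cast
    field_simp
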